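/- Let $K$ be an infinite field, let $K\langle X\rangle$ be the free unital associative $K$-algebra on countably many variables $x_1,x_2,\dots$, and let $n\ge 1$. A polynomial $f\in K\langle X\rangle$ is multilinear if there is a nonempty finite set of variables such that in every monomial of $f$ each variable of this set occurs exactly once and no other variable occurs. A T-ideal is a two-sided ideal of $K\langle X\rangle$ invariant under all $K$-algebra endomorphisms of $K\langle X\rangle$. For $r\ge 0$ let $T_r$ be the smallest T-ideal containing $[x_1,x_2][x_3,x_4]\cdots[x_{2r-1},x_{2r}]$, where $[x,y]=xy-yx$ and $T_0=K\langle X\rangle$. We say that $f$ has commutator-degree $r$ if $f\in T_r$ and $f\notin T_{r+1}$. Let $J$ be the Jacobson radical of the algebra $UT_n(K)$ of upper triangular $n\times n$ matrices (that is, the set of strictly upper triangular matrices), with $J^0=UT_n(K)$, and let $f(UT_n(K))$ be the set of all values of $f$ under substitutions of elements of $UT_n(K)$ for the variables. **Theorem.** Let $f\in K\langle X\rangle$ be a multilinear polynomial. 1. For every $r\ge 0$, if $f$ has commutator-degree $r$, then $f(UT_n(K))=J^r$. 2. For every $0\le r<n$, if $f(UT_n(K))=J^r$, then $f$ has commutator-degree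 $r$. Hence for $r<n$ the image of $f$ on $UT_n(K)$ is $J^r$ if and only if $f$ has commutator-degree $r$. 3. For every $r\ge n$ (where $J^r=\{0\}$), $f(UT_n(K))=J^r$ if and only if $f\in T_n$. 4. In particular, $f(UT_n(K))=J^r$ for some $0\le r\le n$. -/

import Mathlib

noncomputable section

namespace UTImage

/-- The free unital associative algebra `K⟨X⟩` on countably many noncommuting variables
`x₀, x₁, x₂, …` (indexed from `0`). -/
abbrev NCPoly (K : Type*) [Field K] : Type _ := FreeAlgebra K ℕ

/-- `f` is multihomogeneous of multidegree `d`: in each monomial that occurs in `f` with a nonzero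
coefficient, every variable `xᵢ` occurs exactly `d i` times. -/
def IsMultihomogeneous {K : Type*} [Field K] (f : NCPoly K) (d : ℕ → ℕ) : Prop :=
  ∀ w : FreeMonoid ℕ, (FreeAlgebra.equivMonoidAlgebraFreeMonoid f).coeff w ≠ 0 →
    ∀ i : ℕ, (FreeMonoid.toList w).count i = d i

/-- `f` is multilinear: for some nonempty finite set `S` of variables, `f` is multihomogeneous of
degree `1` in each variable of `S` and of degree `0` in all the other variables. -/
def IsMultilinear {K : Type*} [Field K] (f : NCPoly K) : Prop :=
  ∃ S : Finset ℕ, S.Nonempty ∧ IsMultihomogeneous f (fun i => if i ∈ S then 1 else 0)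

/-- The image of `f` on the algebra `A`: the set of all values `f(a₀, a₁, …)` with `aᵢ ∈ A`.
(A value depends only on those `aᵢ` for which `xᵢ` occurs in `f`.) -/
def image {K : Type*} [Field K] (f : NCPoly K) (A : Type*) [Ring A] [Algebra K A] : Set A :=
  Set.range fun a : ℕ → A => FreeAlgebra.lift K a f

/-- A T-ideal: a two-sided ideal of `K⟨X⟩` that is invariant under all endomorphisms of the
`K`-algebra `K⟨X⟩`. -/
def IsTIdeal {K : Type*} [Field K] (I : TwoSidedIdeal (NCPoly K)) : Prop :=
  ∀ φ : NCPoly K →ₐ[K] NCPoly K, ∀ f ∈ I, φ f ∈ I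

/-- The T-ideal generated by `F`, the smallest T-ideal containing `F`. -/
def tIdealSpan {K : Type*} [Field K] (F : Set (NCPoly K)) : TwoSidedIdeal (NCPoly K) :=
  sInf {I | IsTIdeal I ∧ F ⊆ (I : Set (NCPoly K))}

theorem isLeast_tIdealSpan {K : Type*} [Field K] (F : Set (NCPoly K)) :
    IsLeast {I | IsTIdeal I ∧ F ⊆ (I : Set (NCPoly K))} (tIdealSpan F) := by
  refine ⟨⟨fun φ f hf => ?_, fun f hf => ?_⟩, fun I hI => sInf_le hI⟩
  · rw [tIdealSpan, TwoSidedIdeal.mem_sInf] at hf ⊢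
    exact fun I hI => hI.1 φ f (hf I hI)
  · rw [SetLike.mem_coe, tIdealSpan, TwoSidedIdeal.mem_sInf]
    exact fun I hI => hI.2 hf

/-- The product of `r` commutators `[x₀, x₁][x₂, x₃] ⋯ [x_{2r-2}, x_{2r-1}]` in `2r` distinct
variables. For `r = 0` it is the empty product `1`. -/
def commProd (K : Type*) [Field K] (r : ℕ) : NCPoly K :=
  (List.ofFn fun i : Fin r =>
    ⁅FreeAlgebra.ι K (2 * (i : ℕ)), FreeAlgebra.ι K (2 * (i : ℕ) + 1)⁆).prod

/-- The T-ideal generated by a product of `r` commutators; for `r = 0` it is all of `K⟨X⟩`. -/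
def commTIdeal (K : Type*) [Field K] (r : ℕ) : TwoSidedIdeal (NCPoly K) :=
  tIdealSpan {commProd K r}

/-- `f` has commutator-degree `r`. -/
def HasCommutatorDegree {K : Type*} [Field K] (f : NCPoly K) (r : ℕ) : Prop :=
  f ∈ commTIdeal K r ∧ f ∉ commTIdeal K (r + 1)

/-- The algebra of upper triangular `n × n` matrices over `K`. -/
abbrev UT (n : ℕ) (K : Type*) [Field K] : Subalgebra K (Matrix (Fin n) (Fin n) K) :=
  Matrix.blockTriangularSubalgebra K (R := K) (id : Fin n → Fin n)

/-- The `r`-th power of the Jacobson radical of the ring of upper triangular `n × n` matrices, as a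
set; the `0`-th power is the whole ring. -/
def radPow (n : ℕ) (K : Type*) [Field K] (r : ℕ) : Set (UT n K) :=
  ((Ring.jacobson (UT n K) ^ r : Ideal (UT n K)) : Set (UT n K))

end UTImage

end

noncomputable section

namespace UTImage

variable {K : Type*} [Field K]

/-! ### The T-ideals generated by products of commutators -/

/-! The inclusion of the image in `J^r` is a filtration argument: a commutator of upper triangular
matrices is strictly upper triangular, so elements of `T_r` take values in `J^r`
(`lift_mem_filtration`), and `J^r` consists of the matrices supported on superdiagonals `≥ r`
(`mem_radPow`).

For the reverse inclusion, a multilinear `f ∉ T_{r+1}` is first detected by matrix units. Sorting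
each word one letter at a time writes `f`, when its coefficients sum to zero, as `∑ d * g`, with `d
∈ T_1` determined by a letter `x` and the set `T` of letters before it, and `g` multilinear in the
remaining letters. Some `g` is not in `T_r`, and induction produces a staircase of at most `r` steps
along which `f` does not vanish (`exists_walk_ne_zero`). If also `f ∈ T_r`, the filtration forces
exactly `r` steps.

Placing the staircase between row `i` and column `j ≥ i + r`, with the first step taking up all the
slack, gives a nonzero `(i, j)` entry when a fixed variable `v` is the unit `E_{ik}`, `k = j - r +
1`. As `K` is infinite, one generic choice of the other variables serves all `(i, j)` at once. The
value is then linear in `v`, and the value at `E_{ik}` has no entries below row `i` or on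
superdiagonals before `j - i` (`lift_update_single_apply_eq_zero`). The linear map is therefore
triangular with nonzero pivots and reaches all of `J^r` (`exists_lift_eq`).

The remaining claims follow because `J^0, …, J^n` are distinct and every `f ∉ T_n` has a
commutator-degree below `n`. -/

theorem commTIdeal_le {r : ℕ} {I : TwoSidedIdeal (NCPoly K)} (hI : IsTIdeal I)
    (h : commProd K r ∈ I) : commTIdeal K r ≤ I :=
  (isLeast_tIdealSpan _).2 ⟨hI, by simpa using h⟩

theorem isTIdeal_commTIdeal (r : ℕ) : IsTIdeal (commTIdeal K r) := (isLeast_tIdealSpan _).1.1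

theorem commProd_mem (r : ℕ) : commProd K r ∈ commTIdeal K r :=
  (isLeast_tIdealSpan {commProd K r}).1.2 rfl

theorem commTIdeal_zero (f : NCPoly K) : f ∈ commTIdeal K 0 := by
  have h := (commTIdeal K 0).mul_mem_left f _ (commProd_mem 0)
  simpa [commProd] using h

theorem commProd_succ (r : ℕ) : commProd K (r + 1) =
    ⁅FreeAlgebra.ι K 0, FreeAlgebra.ι K 1⁆ *
      FreeAlgebra.lift K (fun i => FreeAlgebra.ι K (i + 2)) (commProd K r) := by
  simp only [commProd, List.ofFn_succ, List.prod_cons, map_list_prod, List.map_ofFn]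
  congr 3
  funext i
  simp [Ring.lie_def, mul_add, add_right_comm]

/-- A factor standing between the commutator and `h` is absorbed by `[a, b] x y = [a, b x] y - b [a,
x] y`. Quantifying over all `φ` makes the set of admissible `h` a T-ideal, so only the generator
needs checking. -/
theorem commutator_mul_mem {r : ℕ} {h : NCPoly K} (hh : h ∈ commTIdeal K r) (a b : NCPoly K) :
    ⁅a, b⁆ * h ∈ commTIdeal K (r + 1) := by
  let I : TwoSidedIdeal (NCPoly K) := TwoSidedIdeal.mk'
    {h | ∀ (φ : NCPoly K →ₐ[K] NCPoly K) (a b : NCPoly K), ⁅a, b⁆ * φ h ∈ commTIdeal K (r + 1)}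
    (fun φ a b => by simp)
    (fun {x y} hx hy φ a b => by
      simpa [mul_add] using (commTIdeal K (r + 1)).add_mem (hx φ a b) (hy φ a b))
    (fun {x} hx φ a b => by
      simpa using (commTIdeal K (r + 1)).neg_mem (hx φ a b))
    (fun {x y} hy φ a b => by
      have h : ⁅a, b⁆ * φ (x * y) = ⁅a, b * φ x⁆ * φ y - b * (⁅a, φ x⁆ * φ y) := by
        simp only [Ring.lie_def, map_mul]
        noncomm_ring
      rw [h]
      exact (commTIdeal K (r + 1)).sub_mem (hy φ _ _)
        ((commTIdeal K (r + 1)).mul_mem_left _ _ (hy φ _ _)))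
    (fun {x y} hx φ a b => by
      simpa [mul_assoc] using (commTIdeal K (r + 1)).mul_mem_right _ (φ y) (hx φ a b))
  have hI : commTIdeal K r ≤ I := by
    refine commTIdeal_le (fun ψ f hf => ?_) ?_
    · rw [TwoSidedIdeal.mem_mk'] at hf ⊢
      intro φ a b
      exact hf (φ.comp ψ) a b
    · rw [TwoSidedIdeal.mem_mk']
      intro φ a b
      have h := isTIdeal_commTIdeal (K := K) (r + 1) (FreeAlgebra.lift K (fun i : ℕ =>
        match i with
        | 0 => a
        | 1 => b
        | j + 2 => φ (FreeAlgebra.ι K j))) _ (commProd_mem (r + 1))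
      rw [commProd_succ, map_mul, Ring.lie_def, map_sub, map_mul, map_mul, FreeAlgebra.lift_ι_apply,
        FreeAlgebra.lift_ι_apply, ← AlgHom.comp_apply] at h
      rw [Ring.lie_def]
      convert! h using 2
      refine DFunLike.congr_fun ?_ _
      ext j
      simp
  exact (TwoSidedIdeal.mem_mk' _ _ _ _ _ _ _).1 (hI hh) (AlgHom.id K _) a b

theorem mul_mem_commTIdeal {r : ℕ} {d h : NCPoly K} (hd : d ∈ commTIdeal K 1)
    (hh : h ∈ commTIdeal K r) : d * h ∈ commTIdeal K (r + 1) := by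
  let I : TwoSidedIdeal (NCPoly K) := TwoSidedIdeal.mk'
    {d | ∀ φ : NCPoly K →ₐ[K] NCPoly K, ∀ h ∈ commTIdeal K r, φ d * h ∈ commTIdeal K (r + 1)}
    (fun φ h _ => by simp)
    (fun {x y} hx hy φ h hh => by
      simpa [add_mul] using (commTIdeal K (r + 1)).add_mem (hx φ h hh) (hy φ h hh))
    (fun {x} hx φ h hh => by
      simpa using (commTIdeal K (r + 1)).neg_mem (hx φ h hh))
    (fun {x y} hy φ h hh => by
      simpa [mul_assoc] using (commTIdeal K (r + 1)).mul_mem_left (φ x) _ (hy φ h hh))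
    (fun {x y} hx φ h hh => by
      simpa [mul_assoc] using hx φ _ ((commTIdeal K r).mul_mem_left (φ y) _ hh))
  have hI : commTIdeal K 1 ≤ I := by
    refine commTIdeal_le (fun ψ f hf => ?_) ?_
    · rw [TwoSidedIdeal.mem_mk'] at hf ⊢
      intro φ
      exact hf (φ.comp ψ)
    · rw [TwoSidedIdeal.mem_mk']
      intro φ h hh
      simpa [commProd, Ring.lie_def] using commutator_mul_mem hh
        (φ (FreeAlgebra.ι K 0)) (φ (FreeAlgebra.ι K 1))
  exact (TwoSidedIdeal.mem_mk' _ _ _ _ _ _ _).1 (hI hd) (AlgHom.id K _) h hh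

/-- Values of a polynomial in a product of `r` commutators at elements of filtration degree `0`
lie in filtration degree `r`, if commutators raise the degree by one. -/
theorem lift_mem_filtration {B : Type*} [Ring B] [Algebra K B]
    (N : ℕ → AddSubgroup B) (halg : ∀ c, algebraMap K B c ∈ N 0)
    (hmul : ∀ p q x y, x ∈ N p → y ∈ N q → x * y ∈ N (p + q))
    (hcomm : ∀ x y, x ∈ N 0 → y ∈ N 0 → x * y - y * x ∈ N 1)
    {r : ℕ} {f : NCPoly K} (hf : f ∈ commTIdeal K r) (a : ℕ → B) (ha : ∀ i, a i ∈ N 0) :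
    FreeAlgebra.lift K a f ∈ N r := by
  have hlift : ∀ (a : ℕ → B), (∀ i, a i ∈ N 0) → ∀ g, FreeAlgebra.lift K a g ∈ N 0 := by
    intro a ha g
    induction g using FreeAlgebra.induction with
    | grade0 c => simpa using halg c
    | grade1 x => simpa using ha x
    | mul x y hx hy => simpa using hmul 0 0 _ _ hx hy
    | add x y hx hy => simpa using (N 0).add_mem hx hy
  let I : TwoSidedIdeal (NCPoly K) := TwoSidedIdeal.mk'
    {f | ∀ a : ℕ → B, (∀ i, a i ∈ N 0) → FreeAlgebra.lift K a f ∈ N r}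
    (fun a _ => by simp [(N r).zero_mem])
    (fun {x y} hx hy a ha => by simpa using (N r).add_mem (hx a ha) (hy a ha))
    (fun {x} hx a ha => by simpa using hx a ha)
    (fun {x y} hy a ha => by
      simpa using hmul 0 r _ _ (hlift a ha x) (hy a ha))
    (fun {x y} hx a ha => by
      simpa using hmul r 0 _ _ (hx a ha) (hlift a ha y))
  have hI : commTIdeal K r ≤ I := by
    refine commTIdeal_le (fun ψ f hf => ?_) ?_
    · rw [TwoSidedIdeal.mem_mk'] at hf ⊢
      intro a ha
      have h := hf (fun i => FreeAlgebra.lift K a (ψ (FreeAlgebra.ι K i))) (fun i => hlift a ha _)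
      convert! h using 1
      rw [← AlgHom.comp_apply]
      refine DFunLike.congr_fun ?_ _
      ext j
      simp
    · rw [TwoSidedIdeal.mem_mk']
      clear hf
      induction r with
      | zero =>
        intro a ha
        simpa [commProd] using halg 1
      | succ r ih =>
        intro a ha
        rw [commProd_succ, map_mul, ← AlgHom.comp_apply, add_comm]
        refine hmul 1 r _ _ ?_ ?_
        · simpa [Ring.lie_def] using hcomm _ _ (ha 0) (ha 1)
        · have h : (FreeAlgebra.lift K a).comp
              (FreeAlgebra.lift K fun i => FreeAlgebra.ι K (i + 2)) =
              FreeAlgebra.lift K fun i => a (i + 2) := by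
            ext j
            simp
          rw [h]
          exact ih _ fun i => ha _
  exact (TwoSidedIdeal.mem_mk' _ _ _ _ _ _ _).1 (hI hf) a ha

/-! ### Words and multilinear polynomials -/

variable (K) in
/-- The monomial of a list of variables. -/
def word (l : List ℕ) : NCPoly K := (l.map (FreeAlgebra.ι K)).prod

@[simp] theorem word_nil : word K [] = 1 := rfl

@[simp] theorem word_cons (x : ℕ) (l : List ℕ) :
    word K (x :: l) = FreeAlgebra.ι K x * word K l := by simp [word]

@[simp] theorem word_append (l l' : List ℕ) : word K (l ++ l') = word K l * word K l' := by
  simp [word]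

theorem word_sub_word_mem {l l' : List ℕ} (h : l.Perm l') :
    word K l - word K l' ∈ commTIdeal K 1 := by
  induction h with
  | nil => simp
  | cons x _ ih =>
    rw [word_cons, word_cons, ← mul_sub]
    exact (commTIdeal K 1).mul_mem_left _ _ ih
  | swap x y l =>
    have h := commutator_mul_mem (commTIdeal_zero (word K l)) (FreeAlgebra.ι K y)
      (FreeAlgebra.ι K x)
    simpa [Ring.lie_def, sub_mul, mul_assoc] using h
  | trans _ _ ih₁ ih₂ => simpa using (commTIdeal K 1).add_mem ih₁ ih₂

/-- A multilinear polynomial as a linear combination of arrangements of a set of variables. -/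
theorem IsMultilinear.exists_eq_sum {f : NCPoly K} (hf : IsMultilinear f) :
    ∃ (S : Finset ℕ) (s : Finset (List ℕ)) (c : List ℕ → K), S.Nonempty ∧
      (∀ w ∈ s, w.Nodup ∧ w.toFinset = S) ∧ f = ∑ w ∈ s, c w • word K w := by
  obtain ⟨S, hS, h⟩ := hf
  let g := FreeAlgebra.equivMonoidAlgebraFreeMonoid f
  refine ⟨S, g.coeff.support, fun w => g.coeff (FreeMonoid.ofList w), hS, fun w hw => ?_, ?_⟩
  · have hc : ∀ i, w.count i = if i ∈ S then 1 else 0 := h w (Finsupp.mem_support_iff.1 hw)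
    constructor
    · rw [List.nodup_iff_count_le_one]
      intro i
      rw [hc i]
      split_ifs <;> simp
    · ext i
      rw [List.mem_toFinset, ← List.count_pos_iff, hc i]
      split_ifs with hi <;> simp [hi]
  · have hf : f = FreeAlgebra.equivMonoidAlgebraFreeMonoid.symm g := by simp [g]
    rw [hf]
    exact (MonoidAlgebra.lift_apply _ g).trans
      (Finset.sum_congr rfl fun w _ => congrArg _ (FreeMonoid.lift_apply _ _))

/-! ### Walks along a word -/

variable (K) in
/-- The letter `x` moves the state from `(a x).1` to `(a x).2`. The value is `1` if the word can be
read from the state `p` and ends in the state `0`, and `0` otherwise. -/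
def walk (a : ℕ → ℕ × ℕ) : ℕ → List ℕ → K
  | p, [] => if p = 0 then 1 else 0
  | p, x :: w => if (a x).1 = p then walk a (a x).2 w else 0

theorem walk_congr {a b : ℕ → ℕ × ℕ} {w : List ℕ} (h : ∀ x ∈ w, a x = b x) (p : ℕ) :
    walk K a p w = walk K b p w := by
  induction w generalizing p with
  | nil => rfl
  | cons x w ih =>
    simp only [walk, h x (by simp)]
    rw [ih fun y hy => h y (by simp [hy])]

theorem walk_eq_zero {a : ℕ → ℕ × ℕ} (ha : ∀ l, (a l).2 ≤ (a l).1) {w : List ℕ} {p y : ℕ}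
    (hy : y ∈ w) (hp : p < (a y).1) : walk K a p w = 0 := by
  induction w generalizing p with
  | nil => simp at hy
  | cons x w ih =>
    rw [walk]
    split_ifs with h
    · rcases List.mem_cons.1 hy with rfl | hy
      · omega
      · exact ih hy (lt_of_le_of_lt ((ha x).trans h.le) hp)
    · rfl

theorem walk_const_zero (w : List ℕ) : walk K (fun _ => (0, 0)) 0 w = 1 := by
  induction w with
  | nil => simp [walk]
  | cons x w ih => simpa [walk] using ih

/-- Prepend to the walk `a` a new top state `p + 1`, at which the letters of `T` stay and which the
letter `x` leaves. -/
def prependState (a : ℕ → ℕ × ℕ) (p x : ℕ) (T : Finset ℕ) (l : ℕ) : ℕ × ℕ :=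
  if l ∈ T then (p + 1, p + 1) else if l = x then (p + 1, p) else a l

/-- In state `p + 1` only letters of `T` and `x` can be read, and the state is never re-entered once
`x` has left it. So a word survives exactly when its letters from `T` come first, followed by `x`.
`U` is the part of `T` still to be read; it shrinks in the induction while the walk keeps the full
`T`. -/
theorem walk_prependState {a : ℕ → ℕ × ℕ} {p x : ℕ} {T : Finset ℕ}
    (ha : ∀ l, (a l).2 ≤ (a l).1 ∧ (a l).1 ≤ p) (hx : x ∉ T) {w : List ℕ} (hw : w.Nodup)
    (hxw : x ∈ w) (U : Finset ℕ) (hU : ∀ y, y ∈ U ↔ y ∈ T ∧ y ∈ w) :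
    walk K (prependState a p x T) (p + 1) w =
      if w[U.card]? = some x ∧ (w.take U.card).toFinset = U then
        walk K a p (w.drop (U.card + 1)) else 0 := by
  have hb : ∀ l, (prependState a p x T l).2 ≤ (prependState a p x T l).1 := by
    intro l
    simp only [prependState]
    split_ifs
    · simp
    · simp
    · exact (ha l).1
  induction w generalizing U with
  | nil => simp at hxw
  | cons y w ih =>
    rw [List.nodup_cons] at hw
    by_cases hyT : y ∈ T
    · have hyx : x ≠ y := fun h => hx (h ▸ hyT)
      have hyU : y ∈ U := (hU y).2 ⟨hyT, by simp⟩
      have hcard : U.card = (U.erase y).card + 1 := (Finset.card_erase_add_one hyU).symm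
      have hUe : ∀ z, z ∈ U.erase y ↔ z ∈ T ∧ z ∈ w := by
        intro z
        rw [Finset.mem_erase, hU, List.mem_cons]
        constructor
        · rintro ⟨h1, h2, h3⟩
          exact ⟨h2, h3.resolve_left h1⟩
        · rintro ⟨h1, h2⟩
          exact ⟨fun h => hw.1 (h ▸ h2), h1, Or.inr h2⟩
      have h := ih hw.2 (by simpa [hyx] using hxw) (U.erase y) hUe
      have hiff : ((List.take (U.erase y).card w).toFinset = U.erase y) ↔
          insert y (List.take (U.erase y).card w).toFinset = U := by
        constructor
        · intro h
          rw [h, Finset.insert_erase hyU]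
        · intro h
          have hy : y ∉ (List.take (U.erase y).card w).toFinset := fun h' =>
            hw.1 (List.mem_of_mem_take (List.mem_toFinset.1 h'))
          rw [← Finset.erase_insert hy, h]
      rw [walk, hcard]
      simp only [prependState, hyT, if_true, List.getElem?_cons_succ, List.take_succ_cons,
        List.toFinset_cons, List.drop_succ_cons] at h ⊢
      rw [h]
      simp only [hiff]
    · by_cases hyx : y = x
      · subst hyx
        rw [walk]
        simp only [prependState, hyT, if_true, if_false]
        rcases U.eq_empty_or_nonempty with rfl | ⟨z, hz⟩
        · simp only [Finset.card_empty, List.getElem?_cons_zero, List.take_zero,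
            List.toFinset_nil, and_self, if_true, zero_add, List.drop_succ_cons, List.drop_zero]
          refine walk_congr (fun z hz => ?_) p
          have h1 : z ∉ T := fun h => by simpa using (hU z).2 ⟨h, by simp [hz]⟩
          have h2 : z ≠ y := fun h => hw.1 (h ▸ hz)
          simp [prependState, h1, h2]
        · rw [if_neg]
          · have hz' := (hU z).1 hz
            refine walk_eq_zero (y := z) hb ?_ ?_
            · exact (List.mem_cons.1 hz'.2).resolve_left fun h => hx (h ▸ hz'.1)
            · simp [prependState, hz'.1]
          · rintro ⟨-, h⟩
            have hpos : 0 < U.card := Finset.card_pos.2 ⟨z, hz⟩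
            obtain ⟨k, hk⟩ := Nat.exists_eq_succ_of_ne_zero hpos.ne'
            have : y ∈ U := by rw [← h, hk]; simp
            exact hx ((hU y).1 this).1
      · rw [walk, if_neg, if_neg]
        · rintro ⟨h, h'⟩
          rcases hk : U.card with _ | k
          · rw [hk] at h
            simp at h
            exact hyx h
          · have : y ∈ U := by rw [← h', hk]; simp
            exact hyT ((hU y).1 this).1
        · simp only [prependState, hyT, hyx, if_false]
          have := (ha y).2
          omega

/-! ### Sorting words letter by letter and detection by walks -/

theorem smul_mem_commTIdeal {r : ℕ} {f : NCPoly K} (c : K) (hf : f ∈ commTIdeal K r) :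
    c • f ∈ commTIdeal K r := by
  rw [Algebra.smul_def]
  exact (commTIdeal K r).mul_mem_left _ _ hf

theorem sum_mem_commTIdeal {r : ℕ} {ι : Type*} (s : Finset ι) (f : ι → NCPoly K)
    (hf : ∀ i ∈ s, f i ∈ commTIdeal K r) : ∑ i ∈ s, f i ∈ commTIdeal K r :=
  sum_mem hf

variable (K) in
/-- The difference between appending `x` to the sorted word on `T` and the sorted word on
`T ∪ {x}`. -/
def insertDefect (x : ℕ) (T : Finset ℕ) : NCPoly K :=
  word K (T.sort (· ≤ ·)) * FreeAlgebra.ι K x - word K ((insert x T).sort (· ≤ ·))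

theorem insertDefect_mem {x : ℕ} {T : Finset ℕ} (hx : x ∉ T) :
    insertDefect K x T ∈ commTIdeal K 1 := by
  have h : (T.sort (· ≤ ·) ++ [x]).Perm ((insert x T).sort (· ≤ ·)) := by
    rw [List.perm_ext_iff_of_nodup]
    · intro y
      simp [or_comm]
    · rw [List.nodup_append]
      simpa using fun y hy (h : y = x) => hx (h ▸ hy)
    · simp
  simpa [insertDefect] using word_sub_word_mem (K := K) h

/-- Telescoping over `j` of the words whose first `j` letters have been sorted. -/
theorem word_eq_sum_insertDefect (w : List ℕ) :
    word K w = word K (w.toFinset.sort (· ≤ ·)) + ∑ j ∈ Finset.range w.length,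
      insertDefect K (w.getD j 0) (w.take j).toFinset * word K (w.drop (j + 1)) := by
  have h := Finset.sum_range_sub' (fun j =>
    word K ((w.take j).toFinset.sort (· ≤ ·)) * word K (w.drop j)) w.length
  simp only [List.take_zero, List.toFinset_nil, Finset.sort_empty, word_nil, List.drop_zero,
    one_mul, List.take_length, List.drop_length, mul_one] at h
  rw [← sub_eq_iff_eq_add', ← h]
  refine Finset.sum_congr rfl fun j hj => ?_
  have hj := Finset.mem_range.1 hj
  have h1 : w.drop j = w.getD j 0 :: w.drop (j + 1) := by
    simp [hj]
  have h2 : (w.take (j + 1)).toFinset = insert (w.getD j 0) (w.take j).toFinset := by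
    ext y
    rw [List.mem_toFinset, ← List.take_concat_get' w j hj, List.mem_append, List.mem_singleton,
      Finset.mem_insert, List.mem_toFinset, List.getD_eq_getElem _ _ hj, or_comm]
  rw [h1, h2, insertDefect, word_cons, sub_mul, mul_assoc]

/-- A multilinear polynomial outside the T-ideal of `r + 1` commutators is detected by a walk with
at most `r` steps. -/
theorem exists_walk_ne_zero (r : ℕ) (S : Finset ℕ) (s : Finset (List ℕ)) (c : List ℕ → K)
    (w : List ℕ → List ℕ) (hw : ∀ i ∈ s, (w i).Nodup ∧ (w i).toFinset = S)
    (h : ∑ i ∈ s, c i • word K (w i) ∉ commTIdeal K (r + 1)) :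
    ∃ p ≤ r, ∃ a : ℕ → ℕ × ℕ, (∀ l, (a l).2 ≤ (a l).1 ∧ (a l).1 ≤ p) ∧
      (1 ≤ p → ∃ v ∈ S, a v = (p, p - 1)) ∧ ∑ i ∈ s, c i * walk K a p (w i) ≠ 0 := by
  induction r generalizing S s c w with
  | zero =>
    refine ⟨0, le_rfl, fun _ => (0, 0), by simp, by simp, fun hc => h ?_⟩
    simp only [walk_const_zero, mul_one] at hc
    -- Modulo `T_1` every word equals the sorted one, so only the sum of the coefficients matters.
    have hsub : ∑ i ∈ s, c i • word K (w i) =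
        ∑ i ∈ s, c i • (word K (w i) - word K (S.sort (· ≤ ·))) := by
      simp [smul_sub, ← Finset.sum_smul, hc]
    rw [hsub]
    refine sum_mem_commTIdeal _ _ fun i hi => smul_mem_commTIdeal _ (word_sub_word_mem ?_)
    rw [List.perm_ext_iff_of_nodup (hw i hi).1 (by simp)]
    intro y
    simp [← (hw i hi).2]
  | succ r ih =>
    by_cases hc : ∑ i ∈ s, c i = 0
    swap
    · refine ⟨0, Nat.zero_le _, fun _ => (0, 0), by simp, by simp, ?_⟩
      simpa [walk_const_zero] using hc
    by_contra H
    refine h ?_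
    have hlen : ∀ i ∈ s, (w i).length = S.card := fun i hi => by
      rw [← (hw i hi).2, List.toFinset_card_of_nodup (hw i hi).1]
    -- The `j`-th defect depends only on this key. Sums stay indexed by the original words because
    -- words with the same key may share a suffix.
    let key (j : ℕ) (i : List ℕ) : ℕ × Finset ℕ := ((w i).getD j 0, ((w i).take j).toFinset)
    have hkey : ∀ j < S.card, ∀ i ∈ s, (key j i).1 ∉ (key j i).2 ∧ (key j i).2.card = j ∧
        (w i)[j]? = some (key j i).1 := by
      intro j hj i hi
      have hj' : j < (w i).length := (hlen i hi).symm ▸ hj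
      have hn := (hw i hi).1
      rw [← List.take_append_drop j (w i), List.nodup_append] at hn
      refine ⟨fun h' => ?_, ?_, ?_⟩
      · refine hn.2.2 _ (List.mem_toFinset.1 h') ((w i).getD j 0) ?_ rfl
        rw [List.drop_eq_getElem_cons hj', List.getD_eq_getElem _ _ hj']
        exact List.mem_cons_self
      · rw [List.toFinset_card_of_nodup hn.1, List.length_take]
        omega
      · simp [key, hj']
    have hrest : ∀ j < S.card, ∀ k, ∑ i ∈ s with key j i = k,
        c i • word K ((w i).drop (j + 1)) ∈ commTIdeal K (r + 1) := by
      intro j hj k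
      by_contra hk
      obtain ⟨x, T⟩ := k
      have hset : ∀ i ∈ s.filter (fun i => key j i = (x, T)),
          ((w i).drop (j + 1)).Nodup ∧ ((w i).drop (j + 1)).toFinset = S \ insert x T := by
        intro i hi
        obtain ⟨hi, hik⟩ := Finset.mem_filter.1 hi
        have hj' : j < (w i).length := (hlen i hi).symm ▸ hj
        have hn := (hw i hi).1
        have hsplit : w i = (w i).take j ++ x :: (w i).drop (j + 1) := by
          have hx : (w i)[j] = x := by simpa [key, hj'] using congrArg Prod.fst hik
          rw [← hx, ← List.drop_eq_getElem_cons hj', List.take_append_drop]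
        have hT : ((w i).take j).toFinset = T := congrArg Prod.snd hik
        have hS := (hw i hi).2
        rw [hsplit] at hn hS
        rw [List.nodup_append, List.nodup_cons] at hn
        refine ⟨hn.2.1.2, ?_⟩
        rw [← hS, ← hT]
        ext y
        simp only [List.mem_toFinset, Finset.mem_sdiff, List.mem_append, List.mem_cons,
          Finset.mem_insert, not_or]
        constructor
        · intro hy
          exact ⟨Or.inr (Or.inr hy), fun h => hn.2.1.1 (h ▸ hy), fun h =>
            hn.2.2 y h y (List.mem_cons_of_mem _ hy) rfl⟩
        · tauto
      obtain ⟨p, hp, a, ha, -, hne⟩ := ih _ _ c (fun i => (w i).drop (j + 1)) hset hk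
      obtain ⟨i₀, hi₀, -⟩ := Finset.exists_ne_zero_of_sum_ne_zero hne
      obtain ⟨hi₀, hik₀⟩ := Finset.mem_filter.1 hi₀
      obtain ⟨hxT, hcard, hget⟩ := hkey j hj i₀ hi₀
      have hTS : T ⊆ S := by
        intro y hy
        rw [← (hw i₀ hi₀).2]
        have : y ∈ (key j i₀).2 := by rw [hik₀]; exact hy
        exact List.mem_toFinset.2 (List.mem_of_mem_take (List.mem_toFinset.1 this))
      have hxS : x ∈ S := by
        rw [hik₀] at hget
        rw [← (hw i₀ hi₀).2]
        exact List.mem_toFinset.2 (List.mem_of_getElem? hget)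
      rw [hik₀] at hxT hcard
      -- The prolonged walk kills every word whose key is not `(x, T)` and reads the suffix of the
      -- others by `a`, so it gives the nonzero sum `hne`.
      refine H ⟨p + 1, by omega, prependState a p x T, ?_, fun _ => ⟨x, hxS, ?_⟩, ?_⟩
      · intro l
        simp only [prependState]
        split_ifs
        · simp
        · simp
        · have := ha l
          omega
      · simp only at hxT
        simp [prependState, hxT]
      · convert! hne using 1
        rw [Finset.sum_filter]
        refine Finset.sum_congr rfl fun i hi => ?_
        have hmem : ∀ y, y ∈ w i ↔ y ∈ S := fun y => by rw [← (hw i hi).2, List.mem_toFinset]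
        rw [walk_prependState ha hxT (hw i hi).1 ((hmem x).2 hxS) T
          (fun y => by rw [hmem]; exact ⟨fun h => ⟨h, hTS h⟩, fun h => h.1⟩)]
        simp only at hcard
        have hiff : ((w i)[j]? = some x ∧ ((w i).take j).toFinset = T) ↔ key j i = (x, T) := by
          rw [(hkey j hj i hi).2.2, Prod.ext_iff]
          simp [key]
        rw [hcard, ← mul_ite_zero]
        simp only [hiff]
    have hf : ∑ i ∈ s, c i • word K (w i) = ∑ j ∈ Finset.range S.card, ∑ i ∈ s,
        c i • (insertDefect K (key j i).1 (key j i).2 * word K ((w i).drop (j + 1))) := by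
      rw [Finset.sum_comm]
      have hsub : ∑ i ∈ s, c i • word K (w i) =
          ∑ i ∈ s, c i • (word K (w i) - word K (S.sort (· ≤ ·))) := by
        simp [smul_sub, ← Finset.sum_smul, hc]
      rw [hsub]
      refine Finset.sum_congr rfl fun i hi => ?_
      rw [← Finset.smul_sum, ← hlen i hi, ← (hw i hi).2]
      congr 1
      rw [sub_eq_iff_eq_add']
      exact word_eq_sum_insertDefect (w i)
    rw [hf]
    refine sum_mem_commTIdeal _ _ fun j hj => ?_
    have hj := Finset.mem_range.1 hj
    rw [← Finset.sum_fiberwise_of_maps_to (t := s.image (key j)) (g := key j)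
      (fun i hi => Finset.mem_image_of_mem _ hi)]
    refine sum_mem_commTIdeal _ _ fun k hk => ?_
    obtain ⟨i₀, hi₀, rfl⟩ := Finset.mem_image.1 hk
    have heq : ∑ i ∈ s with key j i = key j i₀,
        c i • (insertDefect K (key j i).1 (key j i).2 * word K ((w i).drop (j + 1))) =
        insertDefect K (key j i₀).1 (key j i₀).2 *
          ∑ i ∈ s with key j i = key j i₀, c i • word K ((w i).drop (j + 1)) := by
      rw [Finset.mul_sum]
      refine Finset.sum_congr rfl fun i hi => ?_
      rw [(Finset.mem_filter.1 hi).2, mul_smul_comm]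
    rw [heq]
    exact mul_mem_commTIdeal (insertDefect_mem (hkey j hj i₀ hi₀).1) (hrest j hj _)

/-! ### Evaluations on matrices -/

/-- The matrices whose entries left of the `p`-th superdiagonal vanish. -/
def upperLevel (n : ℕ) (R : Type*) [CommRing R] (p : ℕ) :
    AddSubgroup (Matrix (Fin n) (Fin n) R) where
  carrier := {M | ∀ a b : Fin n, (b : ℕ) < a + p → M a b = 0}
  zero_mem' := by simp
  add_mem' := fun {x y} hx hy a b h => by simp [hx a b h, hy a b h]
  neg_mem' := fun {x} hx a b h => by simp [hx a b h]

theorem mem_upperLevel {n : ℕ} {R : Type*} [CommRing R] {p : ℕ} {M : Matrix (Fin n) (Fin n) R} :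
    M ∈ upperLevel n R p ↔ ∀ a b : Fin n, (b : ℕ) < a + p → M a b = 0 := Iff.rfl

theorem mem_upperLevel_zero {n : ℕ} {M : Matrix (Fin n) (Fin n) K} :
    M ∈ upperLevel n K 0 ↔ M ∈ UT n K := by
  rw [mem_upperLevel, Matrix.mem_blockTriangularSubalgebra]
  exact ⟨fun h a b hab => h a b hab, fun h a b hab => h hab⟩

theorem mul_mem_upperLevel {n : ℕ} {R : Type*} [CommRing R] (p q : ℕ)
    (x y : Matrix (Fin n) (Fin n) R) (hx : x ∈ upperLevel n R p) (hy : y ∈ upperLevel n R q) :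
    x * y ∈ upperLevel n R (p + q) := by
  intro a b hab
  rw [Matrix.mul_apply]
  refine Finset.sum_eq_zero fun c _ => ?_
  by_cases hc : (c : ℕ) < a + p
  · rw [hx a c hc, zero_mul]
  · rw [hy c b (by omega), mul_zero]

theorem mul_apply_self_of_mem_upperLevel {n : ℕ} {R : Type*} [CommRing R]
    {x y : Matrix (Fin n) (Fin n) R} (hx : x ∈ upperLevel n R 0) (hy : y ∈ upperLevel n R 0)
    (a : Fin n) : (x * y) a a = x a a * y a a := by
  rw [Matrix.mul_apply]
  refine Finset.sum_eq_single a (fun c _ hc => ?_) (by simp)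
  rcases lt_or_gt_of_ne hc with h | h
  · rw [hx a c (by simpa using h), zero_mul]
  · rw [hy c a (by simpa using h), mul_zero]

theorem commutator_mem_upperLevel {n : ℕ} {R : Type*} [CommRing R]
    (x y : Matrix (Fin n) (Fin n) R) (hx : x ∈ upperLevel n R 0) (hy : y ∈ upperLevel n R 0) :
    x * y - y * x ∈ upperLevel n R 1 := by
  intro a b hab
  rcases eq_or_ne a b with rfl | hne
  · rw [Matrix.sub_apply, mul_apply_self_of_mem_upperLevel hx hy,
      mul_apply_self_of_mem_upperLevel hy hx, mul_comm, sub_self]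
  · have h : (b : ℕ) < a + 0 := by
      have : (a : ℕ) ≠ b := fun h => hne (Fin.ext h)
      omega
    rw [Matrix.sub_apply, mul_mem_upperLevel 0 0 x y hx hy a b h,
      mul_mem_upperLevel 0 0 y x hy hx a b h, sub_zero]

theorem lift_mem_upperLevel {n r : ℕ} {f : NCPoly K} (hf : f ∈ commTIdeal K r)
    {a : ℕ → Matrix (Fin n) (Fin n) K} (ha : ∀ i, a i ∈ upperLevel n K 0) :
    FreeAlgebra.lift K a f ∈ upperLevel n K r :=
  lift_mem_filtration (upperLevel n K)
    (fun c => mem_upperLevel_zero.2 ((UT n K).algebraMap_mem c)) mul_mem_upperLevel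
    commutator_mem_upperLevel hf a ha

theorem lift_word {A : Type*} [Ring A] [Algebra K A] (a : ℕ → A) (w : List ℕ) :
    FreeAlgebra.lift K a (word K w) = (w.map a).prod := by
  induction w with
  | nil => simp
  | cons x w ih => simp [ih]

/-- Substituting matrix units for the variables turns words into walks. -/
theorem lift_word_single {n N : ℕ} (e : ℕ → Fin n) (he : ∀ i ≤ N, ∀ j ≤ N, e i = e j → i = j)
    {a : ℕ → ℕ × ℕ} (ha : ∀ l, (a l).1 ≤ N ∧ (a l).2 ≤ N) (w : List ℕ) {p : ℕ} (hp : p ≤ N) :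
    FreeAlgebra.lift K (fun l => Matrix.single (e (a l).1) (e (a l).2) (1 : K)) (word K w)
      (e p) (e 0) = walk K a p w := by
  induction w generalizing p with
  | nil =>
    simp only [word_nil, map_one, walk, Matrix.one_apply]
    exact if_congr ⟨fun h => he p hp 0 (Nat.zero_le _) h, fun h => by rw [h]⟩ rfl rfl
  | cons x w ih =>
    rw [word_cons, map_mul, FreeAlgebra.lift_ι_apply, walk]
    split_ifs with h
    · rw [← ih (ha x).2, ← h, Matrix.single_mul_apply_same, one_mul]
    · rw [Matrix.single_mul_apply_of_ne]
      exact fun h' => h (he _ hp _ (ha x).1 h').symm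

theorem lift_sum_single {n N : ℕ} (e : ℕ → Fin n) (he : ∀ i ≤ N, ∀ j ≤ N, e i = e j → i = j)
    {a : ℕ → ℕ × ℕ} (ha : ∀ l, (a l).1 ≤ N ∧ (a l).2 ≤ N) (s : Finset (List ℕ)) (c : List ℕ → K)
    {p : ℕ} (hp : p ≤ N) :
    FreeAlgebra.lift K (fun l => Matrix.single (e (a l).1) (e (a l).2) (1 : K))
      (∑ w ∈ s, c w • word K w) (e p) (e 0) = ∑ w ∈ s, c w * walk K a p w := by
  rw [map_sum, Matrix.sum_apply]
  refine Finset.sum_congr rfl fun w _ => ?_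
  rw [map_smul, Matrix.smul_apply, lift_word_single e he ha w hp, smul_eq_mul]

theorem single_mem_upperLevel {n : ℕ} {R : Type*} [CommRing R] {p : ℕ} {i j : Fin n}
    (h : (i : ℕ) + p ≤ j) (c : R) : Matrix.single i j c ∈ upperLevel n R p := by
  intro a b hab
  rw [Matrix.single_apply, if_neg]
  rintro ⟨rfl, rfl⟩
  omega

/-- A walk that detects a polynomial in the T-ideal of `r` commutators has at least `r` steps. -/
theorem le_of_walk_ne_zero {r p : ℕ} {s : Finset (List ℕ)} {c : List ℕ → K}
    (hf : ∑ w ∈ s, c w • word K w ∈ commTIdeal K r) {a : ℕ → ℕ × ℕ}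
    (ha : ∀ l, (a l).2 ≤ (a l).1 ∧ (a l).1 ≤ p) (h : ∑ w ∈ s, c w * walk K a p w ≠ 0) : r ≤ p := by
  by_contra hlt
  refine h ?_
  -- States go down along a walk while indices of upper triangular units go up, hence the reversal.
  -- The detected entry is `(0, p)`, which vanishes in level `r > p`.
  let e : ℕ → Fin (p + 1) := fun i => ⟨p - i, by omega⟩
  have he : ∀ i ≤ p, ∀ j ≤ p, e i = e j → i = j := by
    intro i hi j hj hij
    have := congrArg Fin.val hij
    simp only [e] at this
    omega
  rw [← lift_sum_single e he (fun l => ⟨(ha l).2, (ha l).1.trans (ha l).2⟩) s c le_rfl]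
  refine lift_mem_upperLevel hf (fun l => single_mem_upperLevel ?_ _) _ _ ?_
  · have := (ha l).1
    simp only [e]
    omega
  · simp only [e]
    omega

/-- A multilinear polynomial of commutator-degree `r ≥ 1` has values with a nonzero `(i, j)` entry,
for all `j ≥ i + r`, where a fixed variable is replaced by the matrix unit at `(i, j - r + 1)`. -/
theorem exists_entry_ne_zero {r : ℕ} (hr : 1 ≤ r) {S : Finset ℕ} {s : Finset (List ℕ)}
    {c : List ℕ → K} (hw : ∀ w ∈ s, w.Nodup ∧ w.toFinset = S)
    (h₁ : ∑ w ∈ s, c w • word K w ∈ commTIdeal K r)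
    (h₂ : ∑ w ∈ s, c w • word K w ∉ commTIdeal K (r + 1)) (n : ℕ) :
    ∃ v ∈ S, ∀ i j k : Fin n, (i : ℕ) + r ≤ j → (k : ℕ) + r = j + 1 →
      ∃ A : ℕ → Matrix (Fin n) (Fin n) K, (∀ l, A l ∈ upperLevel n K 0) ∧
        FreeAlgebra.lift K (Function.update A v (Matrix.single i k 1))
          (∑ w ∈ s, c w • word K w) i j ≠ 0 := by
  obtain ⟨p, hp, a, ha, hv, hne⟩ := exists_walk_ne_zero r S s c id hw h₂
  simp only [id] at hne
  obtain rfl : p = r := le_antisymm hp (le_of_walk_ne_zero h₁ ha hne)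
  obtain ⟨v, hvS, hv⟩ := hv hr
  refine ⟨v, hvS, fun i j k hij hk => ?_⟩
  -- States `p - 1, …, 0` occupy the consecutive indices `j - p + 1, …, j`; only the first step,
  -- made by `v`, may be long.
  let e : ℕ → Fin n := fun t => if t < p then ⟨j - t, by omega⟩ else i
  have hlt : ∀ t < p, (e t : ℕ) = j - t := fun t ht => by simp [e, ht]
  have hep : e p = i := by simp [e]
  have he : ∀ x ≤ p, ∀ y ≤ p, e x = e y → x = y := by
    intro x hx y hy hxy
    have h := congrArg Fin.val hxy
    rcases hx.lt_or_eq with hx | rfl <;> rcases hy.lt_or_eq with hy | rfl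
    · rw [hlt x hx, hlt y hy] at h
      omega
    · rw [hlt x hx, hep] at h
      omega
    · rw [hlt y hy, hep] at h
      omega
    · rfl
  have hmono : ∀ x ≤ p, ∀ y ≤ x, (e x : ℕ) ≤ e y := by
    intro x hx y hy
    rcases hx.lt_or_eq with hx | rfl
    · rw [hlt x hx, hlt y (by omega)]
      omega
    · rcases hy.lt_or_eq with hy | rfl
      · rw [hlt y hy, hep]
        omega
      · rfl
  refine ⟨fun l => Matrix.single (e (a l).1) (e (a l).2) 1, fun l =>
    single_mem_upperLevel (hmono _ (ha l).2 _ (ha l).1) _, ?_⟩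
  have hupd : Matrix.single i k (1 : K) = Matrix.single (e (a v).1) (e (a v).2) 1 := by
    rw [hv]
    simp only
    rw [hep, show k = e (p - 1) from Fin.ext (by rw [hlt _ (by omega)]; omega)]
  have hj : e 0 = j := Fin.ext (by rw [hlt 0 (by omega)]; omega)
  rw [hupd, Function.update_eq_self_iff.2 rfl]
  have h := lift_sum_single e he (fun l => ⟨(ha l).2, (ha l).1.trans (ha l).2⟩) s c (le_refl p)
  rw [hep, hj] at h
  rwa [h]

theorem lift_map_matrix {n : ℕ} {R R' : Type*} [CommRing R] [CommRing R'] [Algebra K R]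
    [Algebra K R'] (φ : R →ₐ[K] R') (a : ℕ → Matrix (Fin n) (Fin n) R) (f : NCPoly K)
    (i j : Fin n) : FreeAlgebra.lift K (fun l => (a l).map φ) f i j = φ (FreeAlgebra.lift K a f i j) := by
  have h : FreeAlgebra.lift K (fun l => (a l).map φ) =
      (AlgHom.mapMatrix φ).comp (FreeAlgebra.lift K a) := by
    ext l
    simp
  rw [h]
  simp

/-- Finitely many conditions that an entry of a value be nonzero can be met simultaneously on upper
triangular matrices if each of them can be met. -/
theorem exists_common_entry_ne_zero [Infinite K] {n : ℕ} (f : NCPoly K) (v : ℕ)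
    (Q : Finset (Fin n × Fin n × Fin n))
    (h : ∀ q ∈ Q, ∃ A : ℕ → Matrix (Fin n) (Fin n) K, (∀ l, A l ∈ upperLevel n K 0) ∧
      FreeAlgebra.lift K (Function.update A v (Matrix.single q.1 q.2.2 1)) f q.1 q.2.1 ≠ 0) :
    ∃ A : ℕ → Matrix (Fin n) (Fin n) K, (∀ l, A l ∈ upperLevel n K 0) ∧
      ∀ q ∈ Q, FreeAlgebra.lift K (Function.update A v (Matrix.single q.1 q.2.2 1)) f
        q.1 q.2.1 ≠ 0 := by
  -- Generic upper triangular matrices: each condition becomes a nonzero polynomial `F q`, and a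
  -- nonzero product of polynomials has a nonvanishing point over an infinite field.
  let G : ℕ → Matrix (Fin n) (Fin n) (MvPolynomial (ℕ × Fin n × Fin n) K) := fun l =>
    Matrix.of fun a b => if a ≤ b then MvPolynomial.X (l, a, b) else 0
  let A : (ℕ × Fin n × Fin n → K) → ℕ → Matrix (Fin n) (Fin n) K := fun x l =>
    Matrix.of fun a b => if a ≤ b then x (l, a, b) else 0
  let F : Fin n × Fin n × Fin n → MvPolynomial (ℕ × Fin n × Fin n) K := fun q =>
    FreeAlgebra.lift K (Function.update G v (Matrix.single q.1 q.2.2 1)) f q.1 q.2.1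
  have hF : ∀ x q, MvPolynomial.eval x (F q) =
      FreeAlgebra.lift K (Function.update (A x) v (Matrix.single q.1 q.2.2 1)) f q.1 q.2.1 := by
    intro x q
    have hG : (fun l => (Function.update G v (Matrix.single q.1 q.2.2 1) l).map
        (MvPolynomial.aeval x)) = Function.update (A x) v (Matrix.single q.1 q.2.2 1) := by
      funext l
      rcases eq_or_ne l v with rfl | hl
      · simp [Matrix.map_single]
      · ext a b
        simp only [Function.update_of_ne hl, Matrix.map_apply, G, A, Matrix.of_apply]
        split_ifs <;> simp
    rw [← MvPolynomial.coe_aeval_eq_eval, RingHom.coe_coe, ← lift_map_matrix, hG]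
  have hprod : ∏ q ∈ Q, F q ≠ 0 := by
    rw [Finset.prod_ne_zero_iff]
    intro q hq hq0
    obtain ⟨B, hB, hne⟩ := h q hq
    refine hne ?_
    have hAB : A (fun y => B y.1 y.2.1 y.2.2) = B := by
      funext l
      ext a b
      simp only [A, Matrix.of_apply]
      split_ifs with hab
      · rfl
      · exact (hB l a b (by simpa using hab)).symm
    have hB0 := hF (fun y => B y.1 y.2.1 y.2.2) q
    rw [hq0, map_zero, hAB] at hB0
    exact hB0.symm
  obtain ⟨x, hx⟩ : ∃ x, MvPolynomial.eval x (∏ q ∈ Q, F q) ≠ 0 := by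
    by_contra! hx
    exact hprod (MvPolynomial.funext fun x => by rw [hx, map_zero])
  refine ⟨A x, fun l a b hab => ?_, fun q hq => ?_⟩
  · simp only [A, Matrix.of_apply]
    rw [if_neg]
    simpa using hab
  · rw [map_prod, Finset.prod_ne_zero_iff] at hx
    rw [← hF]
    exact hx q hq

/-! ### Dependence on one variable -/

theorem exists_lift_update_word {B : Type*} [Ring B] [Algebra K B] (A : ℕ → B) {v : ℕ}
    {w : List ℕ} (hw : w.Nodup) (hv : v ∈ w) :
    ∃ P Q : B, ∀ X, FreeAlgebra.lift K (Function.update A v X) (word K w) = P * X * Q := by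
  obtain ⟨u, t, rfl⟩ := List.append_of_mem hv
  rw [List.nodup_append, List.nodup_cons] at hw
  have h : ∀ l : List ℕ, v ∉ l → ∀ X, l.map (Function.update A v X) = l.map A := by
    intro l hl X
    refine List.map_congr_left fun y hy => ?_
    rw [Function.update_of_ne]
    exact fun h => hl (h ▸ hy)
  refine ⟨(u.map A).prod, (t.map A).prod, fun X => ?_⟩
  rw [lift_word, List.map_append, List.map_cons, List.prod_append, List.prod_cons,
    h u fun hu => hw.2.2 v hu v (by simp) rfl, h t hw.2.1.1, Function.update_self, mul_assoc]

theorem exists_lift_update {B : Type*} [Ring B] [Algebra K B] (A : ℕ → B) {v : ℕ} {S : Finset ℕ}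
    (hv : v ∈ S) {s : Finset (List ℕ)} (c : List ℕ → K)
    (hw : ∀ w ∈ s, w.Nodup ∧ w.toFinset = S) :
    ∃ P Q : List ℕ → B, ∀ X, FreeAlgebra.lift K (Function.update A v X)
      (∑ w ∈ s, c w • word K w) = ∑ w ∈ s, c w • (P w * X * Q w) := by
  have h : ∀ w, ∃ P Q : B, w ∈ s →
      ∀ X, FreeAlgebra.lift K (Function.update A v X) (word K w) = P * X * Q := by
    intro w
    by_cases hws : w ∈ s
    · obtain ⟨P, Q, h⟩ := exists_lift_update_word (K := K) A (hw w hws).1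
        (by rw [← List.mem_toFinset, (hw w hws).2]; exact hv)
      exact ⟨P, Q, fun _ => h⟩
    · exact ⟨0, 0, fun h => absurd h hws⟩
  choose P Q h using h
  refine ⟨P, Q, fun X => ?_⟩
  rw [map_sum]
  refine Finset.sum_congr rfl fun w hws => ?_
  rw [map_smul, h w hws]

/-- Matrices over the dual numbers whose standard part lies in level `p`, and whose infinitesimal
part lies in level `max p 1 + t` and vanishes below the `i`-th row. -/
def dualLevel (n t i p : ℕ) (K : Type*) [Field K] :
    AddSubgroup (Matrix (Fin n) (Fin n) (DualNumber K)) where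
  carrier := {M | ∀ a b : Fin n, ((b : ℕ) < a + p → TrivSqZeroExt.fst (M a b) = 0) ∧
    ((b : ℕ) < a + max p 1 + t ∨ i < a → TrivSqZeroExt.snd (M a b) = 0)}
  zero_mem' := by simp
  add_mem' := fun {x y} hx hy a b =>
    ⟨fun h => by simp [(hx a b).1 h, (hy a b).1 h], fun h => by simp [(hx a b).2 h, (hy a b).2 h]⟩
  neg_mem' := fun {x} hx a b =>
    ⟨fun h => by simp [(hx a b).1 h], fun h => by simp [(hx a b).2 h]⟩

theorem mul_mem_dualLevel {n t i : ℕ} (p q : ℕ) (x y : Matrix (Fin n) (Fin n) (DualNumber K))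
    (hx : x ∈ dualLevel n t i p K) (hy : y ∈ dualLevel n t i q K) :
    x * y ∈ dualLevel n t i (p + q) K := by
  intro a b
  rw [Matrix.mul_apply]
  constructor
  · intro h
    rw [TrivSqZeroExt.fst_sum]
    refine Finset.sum_eq_zero fun c _ => ?_
    rw [TrivSqZeroExt.fst_mul]
    by_cases hc : (c : ℕ) < a + p
    · rw [(hx a c).1 hc, zero_mul]
    · rw [(hy c b).1 (by omega), mul_zero]
  · intro h
    rw [TrivSqZeroExt.snd_sum]
    refine Finset.sum_eq_zero fun c _ => ?_
    rw [DualNumber.snd_mul]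
    have h₁ : TrivSqZeroExt.fst (x a c) * TrivSqZeroExt.snd (y c b) = 0 := by
      by_cases hc : (c : ℕ) < a + p
      · rw [(hx a c).1 hc, zero_mul]
      · rw [(hy c b).2 (by omega), mul_zero]
    have h₂ : TrivSqZeroExt.snd (x a c) * TrivSqZeroExt.fst (y c b) = 0 := by
      by_cases hc : (c : ℕ) < a + max p 1 + t ∨ i < a
      · rw [(hx a c).2 hc, zero_mul]
      · rw [(hy c b).1 (by omega), mul_zero]
    rw [h₁, h₂, add_zero]

/-- Infinitesimal parts need no cancellation: since `max 0 1 = max 1 1`, their requirement is the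
same in degrees `0` and `1`. This is why the level is `max p 1 + t`. -/
theorem commutator_mem_dualLevel {n t i : ℕ} (x y : Matrix (Fin n) (Fin n) (DualNumber K))
    (hx : x ∈ dualLevel n t i 0 K) (hy : y ∈ dualLevel n t i 0 K) :
    x * y - y * x ∈ dualLevel n t i 1 K := by
  intro a b
  constructor
  · have hfst : ∀ {z : Matrix (Fin n) (Fin n) (DualNumber K)}, z ∈ dualLevel n t i 0 K →
        z.map (TrivSqZeroExt.fstHom K K K) ∈ upperLevel n K 0 := fun hz a b h => (hz a b).1 h
    intro h
    have := commutator_mem_upperLevel _ _ (hfst hx) (hfst hy) a b h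
    rw [← Matrix.map_mul (f := TrivSqZeroExt.fstHom K K K),
      ← Matrix.map_mul (f := TrivSqZeroExt.fstHom K K K)] at this
    rw [Matrix.sub_apply, TrivSqZeroExt.fst_sub]
    exact this
  · intro h
    rw [Matrix.sub_apply, TrivSqZeroExt.snd_sub,
      (mul_mem_dualLevel 0 0 x y hx hy a b).2 (by simpa using h),
      (mul_mem_dualLevel 0 0 y x hy hx a b).2 (by simpa using h), sub_zero]

/-- The shape of a value of a multilinear polynomial in the T-ideal of `r` commutators at upper
triangular matrices, one of which is a matrix unit. -/
theorem lift_update_single_apply_eq_zero {n r : ℕ} (hr : 1 ≤ r) {S : Finset ℕ} {v : ℕ} (hv : v ∈ S)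
    {s : Finset (List ℕ)} {c : List ℕ → K} (hw : ∀ w ∈ s, w.Nodup ∧ w.toFinset = S)
    (hf : ∑ w ∈ s, c w • word K w ∈ commTIdeal K r) {A : ℕ → Matrix (Fin n) (Fin n) K}
    (hA : ∀ l, A l ∈ upperLevel n K 0) {i j k : Fin n} (hij : (i : ℕ) + r ≤ j)
    (hk : (k : ℕ) + r = j + 1) {a b : Fin n} (hab : (b : ℕ) + i < a + j ∨ i < a) :
    FreeAlgebra.lift K (Function.update A v (Matrix.single i k 1))
      (∑ w ∈ s, c w • word K w) a b = 0 := by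
  set f := ∑ w ∈ s, c w • word K w with hfdef
  let ψ : K →ₐ[K] DualNumber K := TrivSqZeroExt.inlAlgHom K K K
  let B : ℕ → Matrix (Fin n) (Fin n) (DualNumber K) := fun l => (A l).map ψ
  let X : Matrix (Fin n) (Fin n) (DualNumber K) := Matrix.single i k 1
  -- `E_{ik}` lies on superdiagonal `k - i = 1 + t`, and in degree `r ≥ 1` the bound becomes `r + t
  -- = j - i`.
  have hmem : FreeAlgebra.lift K (Function.update B v ((DualNumber.eps : DualNumber K) • X)) f ∈
      dualLevel n (k - i - 1) i r K := by
    refine lift_mem_filtration (dualLevel n (k - i - 1) i · K) (fun c a b => ?_) mul_mem_dualLevel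
      commutator_mem_dualLevel hf _ fun l => ?_
    · rw [Matrix.algebraMap_matrix_apply]
      split_ifs with h
      · subst h
        simp [TrivSqZeroExt.algebraMap_eq_inl']
      · simp
    · rcases eq_or_ne l v with rfl | hl
      · rw [Function.update_self]
        intro a b
        simp only [X, Matrix.smul_apply, Matrix.single_apply]
        split_ifs with h
        · obtain ⟨rfl, rfl⟩ := h
          simp
          omega
        · simp
      · rw [Function.update_of_ne hl]
        intro a b
        refine ⟨fun h => ?_, fun _ => ?_⟩
        · simpa [B, ψ] using hA l a b h
        · simp [B, ψ]
  -- By linearity in `v`, the infinitesimal part of this value is the value at `E_{ik}` itself.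
  have hsmul : FreeAlgebra.lift K (Function.update B v ((DualNumber.eps : DualNumber K) • X)) f =
      (DualNumber.eps : DualNumber K) • FreeAlgebra.lift K (Function.update B v X) f := by
    obtain ⟨P, Q, h⟩ := exists_lift_update B hv c hw
    rw [hfdef, h, h, Finset.smul_sum]
    refine Finset.sum_congr rfl fun w _ => ?_
    rw [mul_smul_comm, smul_mul_assoc, smul_comm]
  have hmap : Function.update B v X =
      fun l => (Function.update A v (Matrix.single i k 1) l).map ψ := by
    funext l
    rcases eq_or_ne l v with rfl | hl
    · simp [X, Matrix.map_single]
    · simp [hl, B]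
  have h := (hmem a b).2 (by omega)
  rw [hsmul, Matrix.smul_apply, hmap, lift_map_matrix] at h
  simpa [ψ] using h

theorem exists_lift_eq {n r : ℕ} [Infinite K] {S : Finset ℕ} (hS : S.Nonempty)
    {s : Finset (List ℕ)} {c : List ℕ → K} (hw : ∀ w ∈ s, w.Nodup ∧ w.toFinset = S)
    (h₁ : ∑ w ∈ s, c w • word K w ∈ commTIdeal K r)
    (h₂ : ∑ w ∈ s, c w • word K w ∉ commTIdeal K (r + 1)) {M : Matrix (Fin n) (Fin n) K}
    (hM : M ∈ upperLevel n K r) : ∃ A : ℕ → Matrix (Fin n) (Fin n) K,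
      (∀ l, A l ∈ upperLevel n K 0) ∧ FreeAlgebra.lift K A (∑ w ∈ s, c w • word K w) = M := by
  rcases Nat.eq_zero_or_pos r with rfl | hr
  · obtain ⟨p, hp, a, ha, -, hne⟩ := exists_walk_ne_zero 0 S s c id hw h₂
    obtain rfl : p = 0 := by omega
    obtain rfl : a = fun _ => (0, 0) := by
      funext l
      have := ha l
      ext <;> simp only <;> omega
    simp only [walk_const_zero, mul_one] at hne
    obtain ⟨v, hv⟩ := hS
    -- With all variables but `v` set to `1`, every word collapses to the value of `v`.
    refine ⟨Function.update 1 v ((∑ w ∈ s, c w)⁻¹ • M), fun l => ?_, ?_⟩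
    · rcases eq_or_ne l v with rfl | hl
      · rw [Function.update_self]
        intro a b h
        rw [Matrix.smul_apply, hM a b h, smul_zero]
      · rw [Function.update_of_ne hl]
        exact mem_upperLevel_zero.2 (one_mem _)
    · have hword : ∀ w ∈ s, ∀ X : Matrix (Fin n) (Fin n) K,
          FreeAlgebra.lift K (Function.update 1 v X) (word K w) = X := by
        intro w hws X
        have hvw : v ∈ w := by rw [← List.mem_toFinset, (hw w hws).2]; exact hv
        rw [lift_word, List.prod_map_eq_pow_single v]
        · rw [List.count_eq_one_of_mem (hw w hws).1 hvw, pow_one, Function.update_self]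
        · intro y hy _
          rw [Function.update_of_ne hy, Pi.one_apply]
      rw [map_sum]
      rw [Finset.sum_congr rfl fun w hws => by rw [map_smul, hword w hws], ← Finset.sum_smul,
        smul_smul, mul_inv_cancel₀ hne, one_smul]
  obtain ⟨v, hv, hex⟩ := exists_entry_ne_zero hr hw h₁ h₂ n
  obtain ⟨A, hA, hne⟩ := exists_common_entry_ne_zero (∑ w ∈ s, c w • word K w) v
    (Finset.univ.filter fun q : Fin n × Fin n × Fin n =>
      (q.1 : ℕ) + r ≤ q.2.1 ∧ (q.2.2 : ℕ) + r = q.2.1 + 1)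
    (fun q hq => hex q.1 q.2.1 q.2.2 (Finset.mem_filter.1 hq).2.1 (Finset.mem_filter.1 hq).2.2)
  obtain ⟨P, Q, hPQ⟩ := exists_lift_update A hv c hw
  let L : Matrix (Fin n) (Fin n) K →ₗ[K] Matrix (Fin n) (Fin n) K :=
    ∑ w ∈ s, c w • (LinearMap.mulRight K (Q w)).comp (LinearMap.mulLeft K (P w))
  have hL : ∀ X, L X = FreeAlgebra.lift K (Function.update A v X) (∑ w ∈ s, c w • word K w) := by
    intro X
    simp [L, hPQ, LinearMap.sum_apply]
  let W := (Subalgebra.toSubmodule (UT n K)).map L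
  -- The measure encodes a lexicographic order: farther superdiagonals first, then higher rows. All
  -- entries of `L E_{ik}` other than the pivot `(i, j)` come earlier in it.
  have hsingle : ∀ μ : ℕ, ∀ i j : Fin n, (i : ℕ) + r ≤ j → (n + i - j) * n + i = μ →
      Matrix.single i j (1 : K) ∈ W := by
    intro μ
    induction μ using Nat.strong_induction_on with
    | _ μ ih =>
      intro i j hij hμ
      let k : Fin n := ⟨j + 1 - r, by omega⟩
      have hk : (k : ℕ) + r = j + 1 := by simp only [k]; omega
      have hY : L (Matrix.single i k 1) ∈ W := Submodule.mem_map_of_mem <| by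
        rw [Subalgebra.mem_toSubmodule, ← mem_upperLevel_zero]
        exact single_mem_upperLevel (by omega) _
      set Y := L (Matrix.single i k 1) with hYdef
      have hYij : Y i j ≠ 0 := by
        rw [hYdef, hL]
        exact hne (i, j, k) (by simp [hij, hk])
      have hzero : ∀ a b : Fin n, (b : ℕ) + i < a + j ∨ i < a → Y a b = 0 := by
        intro a b hab
        rw [hYdef, hL]
        exact lift_update_single_apply_eq_zero hr hv hw h₁ hA hij hk hab
      have hothers : ∑ q ∈ Finset.univ.erase (i, j), Matrix.single q.1 q.2 (Y q.1 q.2) ∈ W := by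
        refine W.sum_mem fun q hq => ?_
        obtain ⟨a, b⟩ := q
        by_cases hab : (b : ℕ) + i < a + j ∨ i < a
        · simp [hzero a b hab]
        · rw [not_or] at hab
          have hab1 := hab.1
          have hab2 : (a : ℕ) ≤ i := not_lt.1 hab.2
          have hsm : Matrix.single a b (Y a b) = Y a b • Matrix.single a b (1 : K) := by simp
          simp only
          rw [hsm]
          refine W.smul_mem _ (ih _ ?_ a b (by omega) rfl)
          rw [← hμ]
          by_cases hd : n + (a : ℕ) - b = n + i - j
          · have hne' : (a : ℕ) ≠ i := by
              intro h
              have h' : (b : ℕ) = j := by omega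
              exact (Finset.mem_erase.1 hq).1 (by rw [Fin.ext h, Fin.ext h'])
            rw [hd]
            omega
          · have hlt : n + (a : ℕ) - b + 1 ≤ n + i - j := by omega
            have := Nat.mul_le_mul_right n hlt
            have := a.2
            rw [add_mul] at *
            omega
      have hsplit : Matrix.single i j (Y i j) +
          ∑ q ∈ Finset.univ.erase (i, j), Matrix.single q.1 q.2 (Y q.1 q.2) = Y := by
        rw [Finset.add_sum_erase Finset.univ
          (fun q : Fin n × Fin n => Matrix.single q.1 q.2 (Y q.1 q.2)) (Finset.mem_univ (i, j)),
          Fintype.sum_prod_type]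
        exact (Matrix.matrix_eq_sum_single Y).symm
      have hmem : Matrix.single i j (Y i j) ∈ W := by
        rw [← eq_sub_iff_add_eq] at hsplit
        rw [hsplit]
        exact W.sub_mem hY hothers
      have := W.smul_mem (Y i j)⁻¹ hmem
      simpa [hYij] using this
  have hMW : M ∈ W := by
    rw [Matrix.matrix_eq_sum_single M]
    refine W.sum_mem fun i _ => W.sum_mem fun j _ => ?_
    by_cases hij : (j : ℕ) < i + r
    · simp [hM i j hij]
    · have := W.smul_mem (M i j) (hsingle _ i j (by omega) rfl)
      simpa using this
  obtain ⟨X, hX, rfl⟩ := hMW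
  refine ⟨Function.update A v X, fun l => ?_, (hL X).symm⟩
  rcases eq_or_ne l v with rfl | hl
  · rw [Function.update_self, mem_upperLevel_zero]
    exact hX
  · rw [Function.update_of_ne hl]
    exact hA l

/-! ### The powers of the Jacobson radical -/

theorem eq_zero_of_mem_upperLevel {n r : ℕ} {R : Type*} [CommRing R]
    {M : Matrix (Fin n) (Fin n) R} (hM : M ∈ upperLevel n R r) (h : n ≤ r) : M = 0 := by
  ext a b
  exact hM a b (by omega)

theorem pow_mem_upperLevel {n : ℕ} {M : Matrix (Fin n) (Fin n) K}
    (hM : M ∈ upperLevel n K 1) (m : ℕ) : M ^ m ∈ upperLevel n K m := by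
  induction m with
  | zero => rw [pow_zero]; exact mem_upperLevel_zero.2 (one_mem _)
  | succ m ih => rw [pow_succ]; exact mul_mem_upperLevel m 1 _ _ ih hM

/-- The `i`-th diagonal entry, as a ring homomorphism on upper triangular matrices. -/
def diagHom (n : ℕ) (K : Type*) [Field K] (i : Fin n) : UT n K →+* K where
  toFun M := (M : Matrix (Fin n) (Fin n) K) i i
  map_one' := by simp
  map_zero' := by simp
  map_add' := by simp
  map_mul' x y := mul_apply_self_of_mem_upperLevel (mem_upperLevel_zero.2 x.2)
    (mem_upperLevel_zero.2 y.2) i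

/-- Each diagonal entry is a surjection onto a field, so it kills the radical. Conversely, for
strictly upper triangular `x` every `y * x` is nilpotent, so `1 + y * x` is invertible. -/
theorem mem_jacobson_UT {n : ℕ} {x : UT n K} :
    x ∈ Ring.jacobson (UT n K) ↔ (x : Matrix (Fin n) (Fin n) K) ∈ upperLevel n K 1 := by
  constructor
  · intro hx a b hab
    rcases (show (b : ℕ) ≤ a by omega).lt_or_eq with h | h
    · exact x.2 (show b < a from h)
    · obtain rfl : b = a := Fin.ext h
      have hs : RingHomSurjective (diagHom n K b) :=
        ⟨fun c => ⟨algebraMap K (UT n K) c, by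
          change algebraMap K (Matrix (Fin n) (Fin n) K) c b b = c
          simp [Matrix.algebraMap_matrix_apply]⟩⟩
      have h := Ring.le_comap_jacobson (diagHom n K b) hx
      rw [Ideal.mem_comap, IsSemisimpleRing.jacobson_eq_bot] at h
      exact h
  · intro hx
    rw [← Ideal.jacobson_bot, Ideal.mem_jacobson_iff]
    intro y
    have hyx : ((y * x : UT n K) : Matrix (Fin n) (Fin n) K) ∈ upperLevel n K 1 := by
      have := mul_mem_upperLevel 0 1 _ _ (mem_upperLevel_zero.2 y.2) hx
      simpa using this
    have hnil : IsNilpotent (y * x) :=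
      ⟨n, Subtype.ext (eq_zero_of_mem_upperLevel (by
        simpa using pow_mem_upperLevel hyx n) le_rfl)⟩
    obtain ⟨u, hu⟩ := hnil.isUnit_one_add
    refine ⟨↑u⁻¹, ?_⟩
    have h := u.inv_mul
    rw [hu, mul_add, mul_one] at h
    rw [Ideal.mem_bot, mul_assoc, add_comm, h, sub_self]

/-- `Q` is the shift with ones on the first superdiagonal, and `P` is `M` with its columns moved one
place to the left; the lost column `0` of `M` is zero. -/
theorem exists_mul_eq_of_mem_upperLevel {n r : ℕ} {M : Matrix (Fin n) (Fin n) K}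
    (hM : M ∈ upperLevel n K (r + 1)) :
    ∃ P ∈ upperLevel n K r, ∃ Q ∈ upperLevel n K 1, P * Q = M := by
  refine ⟨Matrix.of fun a c => if h : (c : ℕ) + 1 < n then M a ⟨c + 1, h⟩ else 0, ?_,
    Matrix.of fun c b => if (c : ℕ) + 1 = b then 1 else 0, ?_, ?_⟩
  · intro a c hc
    simp only [Matrix.of_apply]
    split_ifs with h
    · exact hM a _ (by simp only; omega)
    · rfl
  · intro c b hb
    rw [Matrix.of_apply, if_neg (by omega)]
  · ext a b
    rw [Matrix.mul_apply]
    simp only [Matrix.of_apply, mul_ite, mul_one, mul_zero]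
    rcases Nat.eq_zero_or_pos (b : ℕ) with hb | hb
    · rw [hM a b (by omega)]
      exact Finset.sum_eq_zero fun c _ => if_neg (by omega)
    · rw [Finset.sum_eq_single (⟨b - 1, by omega⟩ : Fin n)]
      · have h : (b : ℕ) - 1 + 1 = b := by omega
        simp [h]
      · intro c _ hc
        refine if_neg fun h => hc (Fin.ext ?_)
        simp only
        omega
      · simp

theorem mem_radPow {n r : ℕ} {x : UT n K} :
    x ∈ radPow n K r ↔ (x : Matrix (Fin n) (Fin n) K) ∈ upperLevel n K r := by
  change x ∈ Ring.jacobson (UT n K) ^ r ↔ _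
  induction r generalizing x with
  | zero =>
    rw [Submodule.pow_zero, Ideal.one_eq_top, mem_upperLevel_zero]
    exact iff_of_true Submodule.mem_top x.2
  | succ r ih =>
    rw [Submodule.pow_succ]
    constructor
    · let I : Ideal (UT n K) :=
        { carrier := {x | (x : Matrix (Fin n) (Fin n) K) ∈ upperLevel n K (r + 1)}
          add_mem' := fun {x y} hx hy => by simpa using (upperLevel n K (r + 1)).add_mem hx hy
          zero_mem' := by simp [(upperLevel n K (r + 1)).zero_mem]
          smul_mem' := fun c x hx => by
            simpa using mul_mem_upperLevel 0 (r + 1) _ _ (mem_upperLevel_zero.2 c.2) hx }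
      have h : Ring.jacobson (UT n K) ^ r * Ring.jacobson (UT n K) ≤ I :=
        Ideal.mul_le.2 fun y hy z hz => mul_mem_upperLevel r 1 _ _ (ih.1 hy) (mem_jacobson_UT.1 hz)
      exact fun hx => h hx
    · intro hx
      obtain ⟨P, hP, Q, hQ, hPQ⟩ := exists_mul_eq_of_mem_upperLevel hx
      have hle : ∀ {q} {M : Matrix (Fin n) (Fin n) K}, M ∈ upperLevel n K q → M ∈ UT n K :=
        fun h => mem_upperLevel_zero.1 fun a b hab => h a b (by omega)
      have hx' : x = (⟨P, hle hP⟩ : UT n K) * ⟨Q, hle hQ⟩ := Subtype.ext hPQ.symm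
      rw [hx']
      exact Ideal.mul_mem_mul (ih.2 hP) (mem_jacobson_UT.2 hQ)

theorem radPow_eq_zero {n r : ℕ} (h : n ≤ r) : radPow n K r = {0} := by
  ext x
  rw [mem_radPow, Set.mem_singleton_iff]
  refine ⟨fun hx => Subtype.ext (eq_zero_of_mem_upperLevel hx h), ?_⟩
  rintro rfl
  exact (upperLevel n K r).zero_mem

/-- The unit `E_{0r}` lies in `J^r` but in no higher power. -/
theorem le_of_radPow_eq {n r q : ℕ} (hr : r < n) (h : radPow n K q = radPow n K r) : q ≤ r := by
  let i : Fin n := ⟨0, by omega⟩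
  let j : Fin n := ⟨r, hr⟩
  have hmem : Matrix.single i j (1 : K) ∈ upperLevel n K r :=
    single_mem_upperLevel (by simp [i, j]) _
  let x : UT n K := ⟨Matrix.single i j 1, mem_upperLevel_zero.1
    (single_mem_upperLevel (by simp [i]) _)⟩
  have hx : x ∈ radPow n K q := h ▸ mem_radPow.2 hmem
  by_contra hlt
  have := mem_radPow.1 hx i j (by simp only [i, j]; omega)
  simp [x] at this

/-! ### The image -/

theorem coe_lift {n : ℕ} (a : ℕ → UT n K) (f : NCPoly K) :
    ((FreeAlgebra.lift K a f : UT n K) : Matrix (Fin n) (Fin n) K) =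
      FreeAlgebra.lift K (fun l => (a l : Matrix (Fin n) (Fin n) K)) f := by
  have h : (UT n K).val.comp (FreeAlgebra.lift K a) =
      FreeAlgebra.lift K (fun l => (a l : Matrix (Fin n) (Fin n) K)) := by
    ext l
    simp
  rw [← h]
  rfl

theorem image_subset_radPow {n r : ℕ} {f : NCPoly K} (hf : f ∈ commTIdeal K r) :
    image f (UT n K) ⊆ radPow n K r := by
  rintro _ ⟨a, rfl⟩
  rw [mem_radPow]
  simp only [coe_lift]
  exact lift_mem_upperLevel hf fun l => mem_upperLevel_zero.2 (a l).2

theorem HasCommutatorDegree.image_eq [Infinite K] (n : ℕ) {r : ℕ} {f : NCPoly K}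
    (hf : IsMultilinear f) (h : HasCommutatorDegree f r) : image f (UT n K) = radPow n K r := by
  refine (image_subset_radPow h.1).antisymm fun x hx => ?_
  obtain ⟨S, s, c, hS, hw, rfl⟩ := hf.exists_eq_sum
  obtain ⟨A, hA, hAx⟩ := exists_lift_eq hS hw h.1 h.2 (mem_radPow.1 hx)
  refine ⟨fun l => ⟨A l, mem_upperLevel_zero.1 (hA l)⟩, Subtype.ext ?_⟩
  simp only [coe_lift]
  exact hAx

theorem exists_hasCommutatorDegree {n : ℕ} {f : NCPoly K} (hf : f ∉ commTIdeal K n) :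
    ∃ r < n, HasCommutatorDegree f r := by
  induction n with
  | zero => exact absurd (commTIdeal_zero f) hf
  | succ n ih =>
    by_cases h : f ∈ commTIdeal K n
    · exact ⟨n, Nat.lt_succ_self n, h, hf⟩
    · obtain ⟨r, hr, h⟩ := ih h
      exact ⟨r, by omega, h⟩

theorem image_eq_of_mem {n r : ℕ} (hr : n ≤ r) {f : NCPoly K} (hf : f ∈ commTIdeal K n) :
    image f (UT n K) = radPow n K r := by
  have h := image_subset_radPow (n := n) hf
  rw [radPow_eq_zero le_rfl] at h
  rw [radPow_eq_zero hr]
  exact (Set.range_nonempty _).subset_singleton_iff.1 h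

end UTImage

end

theorem theorem4p1 {K : Type*} [Field K] [Infinite K] (n : ℕ) (f : UTImage.NCPoly K)
    (hf : UTImage.IsMultilinear f) :
    (∀ r : ℕ, UTImage.HasCommutatorDegree f r →
      UTImage.image f (UTImage.UT n K) = UTImage.radPow n K r) ∧
    (∀ r : ℕ, r < n → UTImage.image f (UTImage.UT n K) = UTImage.radPow n K r →
      UTImage.HasCommutatorDegree f r) ∧
    (∀ r : ℕ, n ≤ r →
      (UTImage.image f (UTImage.UT n K) = UTImage.radPow n K r ↔ f ∈ UTImage.commTIdeal K n)) ∧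
    (∃ r : ℕ, r ≤ n ∧ UTImage.image f (UTImage.UT n K) = UTImage.radPow n K r) := by
  refine ⟨fun r h => h.image_eq n hf, fun r hr h => ?_, fun r hr => ⟨fun h => ?_, fun h =>
    UTImage.image_eq_of_mem hr h⟩, ?_⟩
  -- If `f ∈ T_n` the image would be `J^n`, which differs from `J^r`. Otherwise `f` has some degree
  -- `q < n`, and `J^q = J^r` forces `q = r`.
  · by_cases hn : f ∈ UTImage.commTIdeal K n
    · have h' := UTImage.image_eq_of_mem le_rfl hn
      rw [h] at h'
      exact absurd (UTImage.le_of_radPow_eq hr h'.symm) (by omega)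
    · obtain ⟨q, hq, hfq⟩ := UTImage.exists_hasCommutatorDegree hn
      have h' := (hfq.image_eq n hf).symm.trans h
      rwa [← le_antisymm (UTImage.le_of_radPow_eq hr h') (UTImage.le_of_radPow_eq hq h'.symm)]
  · by_contra hn
    obtain ⟨q, hq, hfq⟩ := UTImage.exists_hasCommutatorDegree hn
    have h' := h.symm.trans (hfq.image_eq n hf)
    exact absurd (UTImage.le_of_radPow_eq hq h') (by omega)
  · by_cases hn : f ∈ UTImage.commTIdeal K n
    · exact ⟨n, le_rfl, UTImage.image_eq_of_mem le_rfl hn⟩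
    · obtain ⟨q, hq, hfq⟩ := UTImage.exists_hasCommutatorDegree hn
      exact ⟨q, hq.le, hfq.image_eq n hf⟩
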